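/- For an integer $k \ge 1$ and a positive integer $n$ let $\sigma_k(n) = \sum_{d \mid n} d^k$, the sum being over the positive divisors of $n$, and write $\sigma(n) = \sigma_1(n)$. Then the following congruences hold for every positive integer $n$ satisfying the stated condition (with no condition in (iv)): (i) $(6n-5)\,\sigma(n) \equiv \sigma_3(n) \pmod{24}$, if $\gcd(n,6)=1$; (ii) $\sigma(n) + 2n\,\sigma_3(n) \equiv 3\,\sigma_5(n) \pmod{16}$, if $2 \nmid n$; (iii) $n\,\sigma(n) + 5n\,\sigma_7(n) \equiv 6n^2\,\sigma_5(n) \pmod{2^3\cdot 3^2\cdot 7}$, if $\gcd(n,42)=1$; (iv) $20\,\sigma_7(n) + 11\,\sigma_9(n) \equiv \sigma(n) + 30n\,\sigma_7(n) \pmod{2^5\cdot 3\cdot 5}$; (v) $5\,\sigma(n) + 6n\,\sigma_7(n) \equiv 11\,\sigma_9(n) \pmod{2^5}$, if $2 \nmid n$; (vi) $\sigma(n) + 2n\,\sigma_3(n) \equiv 3\,\sigma_5(n) \pmod{2^4\cdot 5}$, if $\gcd(n,10)=1$; (vii) $\sigma(n) + 10(3n-2)\,\sigma_7(n) \equiv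 11\,\sigma_9(n) \pmod{2^3\cdot 3\cdot 5}$, if $\gcd(n,30)=1$. -/

import Mathlib

open scoped ArithmeticFunction.sigma

/-! Each congruence says that a divisor sum of a polynomial `P d n` vanishes modulo `q`. Pairing `d`
with `e = n / d` and substituting `n = d * e` leaves an identity in two residues, a finite check in
`ZMod q`; prime power factors of the modulus are treated separately. Only (iv) modulo 32 resists,
since even `n` are allowed: there the power of two is split off by multiplicativity. -/

/-- A sum over the divisors of `n` vanishes if the contributions of complementary divisors
cancel. -/
theorem sum_divisors_eq_zero_of_pairing {R : Type*} [AddCommMonoid R] (n : ℕ) (f : ℕ → R)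
    (hpair : ∀ d e, d * e = n → f d + f e = 0) (hdiag : ∀ d, d * d = n → f d = 0) :
    ∑ d ∈ n.divisors, f d = 0 := by
  refine Finset.sum_involution (fun d _ => n / d) ?_ ?_ ?_ ?_
  · intro d hd
    exact hpair d (n / d) (Nat.mul_div_cancel' (Nat.dvd_of_mem_divisors hd))
  · intro d hd hne heq
    refine hne (hdiag d ?_)
    nth_rewrite 2 [← heq]
    exact Nat.mul_div_cancel' (Nat.dvd_of_mem_divisors hd)
  · intro d hd
    rw [Nat.mem_divisors] at hd ⊢
    exact ⟨Nat.div_dvd_of_dvd hd.1, hd.2⟩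
  · intro d hd
    rw [Nat.mem_divisors] at hd
    exact Nat.div_div_self hd.1 hd.2

/-- The hypotheses mention only residues, so over `ZMod q` they are decidable. The diagonal needs
its own check: `2 * P = 0` does not give `P = 0` when `q` is even. -/
theorem sum_divisors_cast_eq_zero {R : Type*} [CommSemiring R] (S : R → Prop) (P : R → R → R)
    (hpair : ∀ a b, S (a * b) → P a (a * b) + P b (a * b) = 0)
    (hdiag : ∀ a, S (a * a) → P a (a * a) = 0) {n : ℕ} (hn : S n) :
    ∑ d ∈ n.divisors, P d n = 0 := by
  refine sum_divisors_eq_zero_of_pairing n _ (fun d e h => ?_) (fun d h => ?_) <;> subst h <;>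
    push_cast at hn ⊢
  exacts [hpair _ _ hn, hdiag _ hn]

theorem sigma_cast_eq_sum (R : Type*) [CommSemiring R] (k n : ℕ) :
    ((σ k n : ℕ) : R) = ∑ d ∈ n.divisors, (d : R) ^ k := by
  rw [ArithmeticFunction.sigma_apply]
  push_cast
  rfl

theorem coprime_val_natCast {q n : ℕ} (h : n.Coprime q) :
    (n : ZMod q).val.Coprime q := by
  rw [ZMod.val_natCast, Nat.Coprime, ← Nat.gcd_rec, Nat.gcd_comm]
  exact h

/-- To prove a congruence modulo a coprime product, prove it modulo each factor. -/
theorem modEq_mul_of_coprime {a b : ℤ} (p q : ℕ) (h : Nat.Coprime p q)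
    (hp : a ≡ b [ZMOD p]) (hq : a ≡ b [ZMOD q]) : a ≡ b [ZMOD ((p * q : ℕ) : ℤ)] := by
  rw [Nat.cast_mul]
  exact (Int.modEq_and_modEq_iff_modEq_mul (by simpa using h)).1 ⟨hp, hq⟩

section Congruences

variable {n : ℕ}

theorem sigma_congr_one_three {q : ℕ}
    (hpair : ∀ a b : ZMod q, (a * b).val.Coprime q →
      ((6 * (a * b) - 5) * a - a ^ 3) + ((6 * (a * b) - 5) * b - b ^ 3) = 0)
    (hdiag : ∀ a : ZMod q, (a * a).val.Coprime q → (6 * (a * a) - 5) * a - a ^ 3 = 0)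
    (hn : n.Coprime q) :
    (6 * (n : ℤ) - 5) * (σ 1 n : ℤ) ≡ (σ 3 n : ℤ) [ZMOD q] := by
  have h := sum_divisors_cast_eq_zero (fun x : ZMod q => x.val.Coprime q)
    (fun a m => (6 * m - 5) * a - a ^ 3) hpair hdiag (coprime_val_natCast hn)
  rw [← ZMod.intCast_eq_intCast_iff, ← sub_eq_zero, ← h]
  push_cast
  simp only [sigma_cast_eq_sum, Finset.mul_sum, ← Finset.sum_sub_distrib, pow_one]

theorem sigma_congr_one_three_five {q : ℕ}
    (hpair : ∀ a b : ZMod q, (a * b).val.Coprime q →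
      (a + 2 * (a * b) * a ^ 3 - 3 * a ^ 5) + (b + 2 * (a * b) * b ^ 3 - 3 * b ^ 5) = 0)
    (hdiag : ∀ a : ZMod q, (a * a).val.Coprime q → a + 2 * (a * a) * a ^ 3 - 3 * a ^ 5 = 0)
    (hn : n.Coprime q) :
    (σ 1 n : ℤ) + 2 * (n : ℤ) * (σ 3 n : ℤ) ≡ 3 * (σ 5 n : ℤ) [ZMOD q] := by
  have h := sum_divisors_cast_eq_zero (fun x : ZMod q => x.val.Coprime q)
    (fun a m => a + 2 * m * a ^ 3 - 3 * a ^ 5) hpair hdiag (coprime_val_natCast hn)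
  rw [← ZMod.intCast_eq_intCast_iff, ← sub_eq_zero, ← h]
  push_cast
  simp only [sigma_cast_eq_sum, Finset.mul_sum, ← Finset.sum_sub_distrib,
    ← Finset.sum_add_distrib, pow_one]

theorem sigma_congr_one_five_seven {q : ℕ}
    (hpair : ∀ a b : ZMod q, (a * b).val.Coprime q →
      ((a * b) * a + 5 * (a * b) * a ^ 7 - 6 * (a * b) ^ 2 * a ^ 5)
        + ((a * b) * b + 5 * (a * b) * b ^ 7 - 6 * (a * b) ^ 2 * b ^ 5) = 0)
    (hdiag : ∀ a : ZMod q, (a * a).val.Coprime q →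
      (a * a) * a + 5 * (a * a) * a ^ 7 - 6 * (a * a) ^ 2 * a ^ 5 = 0)
    (hn : n.Coprime q) :
    (n : ℤ) * (σ 1 n : ℤ) + 5 * (n : ℤ) * (σ 7 n : ℤ)
      ≡ 6 * (n : ℤ) ^ 2 * (σ 5 n : ℤ) [ZMOD q] := by
  have h := sum_divisors_cast_eq_zero (fun x : ZMod q => x.val.Coprime q)
    (fun a m => m * a + 5 * m * a ^ 7 - 6 * m ^ 2 * a ^ 5) hpair hdiag (coprime_val_natCast hn)
  rw [← ZMod.intCast_eq_intCast_iff, ← sub_eq_zero, ← h]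
  push_cast
  simp only [sigma_cast_eq_sum, Finset.mul_sum, ← Finset.sum_sub_distrib,
    ← Finset.sum_add_distrib, pow_one]

theorem sigma_congr_one_seven_nine {q : ℕ}
    (hpair : ∀ a b : ZMod q,
      (20 * a ^ 7 + 11 * a ^ 9 - (a + 30 * (a * b) * a ^ 7))
        + (20 * b ^ 7 + 11 * b ^ 9 - (b + 30 * (a * b) * b ^ 7)) = 0)
    (hdiag : ∀ a : ZMod q, 20 * a ^ 7 + 11 * a ^ 9 - (a + 30 * (a * a) * a ^ 7) = 0) :
    20 * (σ 7 n : ℤ) + 11 * (σ 9 n : ℤ)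
      ≡ (σ 1 n : ℤ) + 30 * (n : ℤ) * (σ 7 n : ℤ) [ZMOD q] := by
  have h := sum_divisors_cast_eq_zero (fun _ : ZMod q => True)
    (fun a m => 20 * a ^ 7 + 11 * a ^ 9 - (a + 30 * m * a ^ 7)) (fun a b _ => hpair a b)
    (fun a _ => hdiag a) (n := n) trivial
  rw [← ZMod.intCast_eq_intCast_iff, ← sub_eq_zero, ← h]
  push_cast
  simp only [sigma_cast_eq_sum, Finset.mul_sum, ← Finset.sum_sub_distrib,
    ← Finset.sum_add_distrib, pow_one]

theorem sigma_congr_five_one_seven_nine {q : ℕ}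
    (hpair : ∀ a b : ZMod q, (a * b).val.Coprime q →
      (5 * a + 6 * (a * b) * a ^ 7 - 11 * a ^ 9)
        + (5 * b + 6 * (a * b) * b ^ 7 - 11 * b ^ 9) = 0)
    (hdiag : ∀ a : ZMod q, (a * a).val.Coprime q →
      5 * a + 6 * (a * a) * a ^ 7 - 11 * a ^ 9 = 0)
    (hn : n.Coprime q) :
    5 * (σ 1 n : ℤ) + 6 * (n : ℤ) * (σ 7 n : ℤ) ≡ 11 * (σ 9 n : ℤ) [ZMOD q] := by
  have h := sum_divisors_cast_eq_zero (fun x : ZMod q => x.val.Coprime q)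
    (fun a m => 5 * a + 6 * m * a ^ 7 - 11 * a ^ 9) hpair hdiag (coprime_val_natCast hn)
  rw [← ZMod.intCast_eq_intCast_iff, ← sub_eq_zero, ← h]
  push_cast
  simp only [sigma_cast_eq_sum, Finset.mul_sum, ← Finset.sum_sub_distrib,
    ← Finset.sum_add_distrib, pow_one]

theorem sigma_congr_one_seven_nine_of_coprime {q : ℕ}
    (hpair : ∀ a b : ZMod q, (a * b).val.Coprime q →
      (a + 10 * (3 * (a * b) - 2) * a ^ 7 - 11 * a ^ 9)
        + (b + 10 * (3 * (a * b) - 2) * b ^ 7 - 11 * b ^ 9) = 0)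
    (hdiag : ∀ a : ZMod q, (a * a).val.Coprime q →
      a + 10 * (3 * (a * a) - 2) * a ^ 7 - 11 * a ^ 9 = 0)
    (hn : n.Coprime q) :
    (σ 1 n : ℤ) + 10 * (3 * (n : ℤ) - 2) * (σ 7 n : ℤ) ≡ 11 * (σ 9 n : ℤ) [ZMOD q] := by
  have h := sum_divisors_cast_eq_zero (fun x : ZMod q => x.val.Coprime q)
    (fun a m => a + 10 * (3 * m - 2) * a ^ 7 - 11 * a ^ 9) hpair hdiag (coprime_val_natCast hn)
  rw [← ZMod.intCast_eq_intCast_iff, ← sub_eq_zero, ← h]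
  push_cast
  simp only [sigma_cast_eq_sum, Finset.mul_sum, ← Finset.sum_sub_distrib,
    ← Finset.sum_add_distrib, pow_one]

/-- Modulo `32`, only the first power sum sees the even divisors of a power of two. -/
theorem sigma_two_pow_cast {k : ℕ} (hk : 5 ≤ k) (a : ℕ) : ((σ k (2 ^ a) : ℕ) : ZMod 32) = 1 := by
  rw [ArithmeticFunction.sigma_apply_prime_pow Nat.prime_two, Finset.sum_range_succ']
  push_cast
  rw [Finset.sum_eq_zero, zero_add, zero_mul, pow_zero]
  intro i _
  obtain ⟨j, hj⟩ : ∃ j, (i + 1) * k = 5 + j := ⟨(i + 1) * k - 5, by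
    have : k ≤ (i + 1) * k := Nat.le_mul_of_pos_left _ i.succ_pos
    omega⟩
  rw [hj, pow_add, show (2 : ZMod 32) ^ 5 = 0 by decide, zero_mul]

theorem sigma_one_two_pow_cast (R : Type*) [CommRing R] (a : ℕ) :
    ((σ 1 (2 ^ a) : ℕ) : R) = 2 * 2 ^ a - 1 := by
  rw [ArithmeticFunction.sigma_apply_prime_pow Nat.prime_two]
  push_cast
  simp only [mul_one]
  have h := geom_sum_mul (2 : R) (a + 1)
  rw [show (2 : R) - 1 = 1 by ring, mul_one, pow_succ'] at h
  exact h

/-- Direct pairing fails for even `n`: when `n = 4`, the divisor 2 contributes -2. With `n = 2 ^ a *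
m`, `m` odd, the factors at 2 become 1, 1 and `2 * 2 ^ a - 1`. -/
theorem sigma_congr_one_seven_nine_thirtytwo (hn : 0 < n) :
    20 * (σ 7 n : ℤ) + 11 * (σ 9 n : ℤ)
      ≡ (σ 1 n : ℤ) + 30 * (n : ℤ) * (σ 7 n : ℤ) [ZMOD (32 : ℕ)] := by
  obtain ⟨a, m, hm, rfl⟩ := Nat.exists_eq_two_pow_mul_odd hn.ne'
  have hcop : (2 ^ a).Coprime m := (Nat.coprime_two_left.2 hm).pow_left a
  have hm32 : m.Coprime 32 := by
    simpa using ((Nat.coprime_two_left.2 hm).pow_left 5).symm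
  have hmul (k : ℕ) : σ k (2 ^ a * m) = σ k (2 ^ a) * σ k m :=
    ArithmeticFunction.isMultiplicative_sigma.map_mul_of_coprime hcop
  -- The difference of the two sides is affine in `2 ^ a`; `h0` kills its constant term and `h1` its
  -- coefficient, each by pairing over the odd `m`.
  have h0 := sum_divisors_cast_eq_zero (fun x : ZMod 32 => x.val.Coprime 32)
    (fun d _ => 20 * d ^ 7 + 11 * d ^ 9 + d) (by decide +kernel) (by decide +kernel)
    (coprime_val_natCast hm32)
  have h1 := sum_divisors_cast_eq_zero (fun x : ZMod 32 => x.val.Coprime 32)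
    (fun d m => 30 * m * d ^ 7 + 2 * d) (by decide +kernel) (by decide +kernel)
    (coprime_val_natCast hm32)
  simp only [Finset.sum_add_distrib, ← Finset.mul_sum, ← sigma_cast_eq_sum] at h0 h1
  have hs : ∑ d ∈ m.divisors, (d : ZMod 32) = (σ 1 m : ℕ) := by
    simp [sigma_cast_eq_sum]
  rw [hs] at h0 h1
  rw [← ZMod.intCast_eq_intCast_iff]
  simp only [hmul]
  push_cast
  rw [sigma_two_pow_cast (by norm_num), sigma_two_pow_cast (by norm_num), sigma_one_two_pow_cast]
  linear_combination h0 - 2 ^ a * h1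

end Congruences

theorem corollary2p12 (n : ℕ) (hn : 0 < n) :
    (Nat.gcd n 6 = 1 →
      (6 * (n : ℤ) - 5) * (σ 1 n : ℤ) ≡ (σ 3 n : ℤ) [ZMOD 24]) ∧
    (¬ 2 ∣ n →
      (σ 1 n : ℤ) + 2 * (n : ℤ) * (σ 3 n : ℤ) ≡ 3 * (σ 5 n : ℤ) [ZMOD 16]) ∧
    (Nat.gcd n 42 = 1 →
      (n : ℤ) * (σ 1 n : ℤ) + 5 * (n : ℤ) * (σ 7 n : ℤ)
        ≡ 6 * (n : ℤ) ^ 2 * (σ 5 n : ℤ) [ZMOD 2 ^ 3 * 3 ^ 2 * 7]) ∧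
    (20 * (σ 7 n : ℤ) + 11 * (σ 9 n : ℤ)
        ≡ (σ 1 n : ℤ) + 30 * (n : ℤ) * (σ 7 n : ℤ) [ZMOD 2 ^ 5 * 3 * 5]) ∧
    (¬ 2 ∣ n →
      5 * (σ 1 n : ℤ) + 6 * (n : ℤ) * (σ 7 n : ℤ) ≡ 11 * (σ 9 n : ℤ) [ZMOD 2 ^ 5]) ∧
    (Nat.gcd n 10 = 1 →
      (σ 1 n : ℤ) + 2 * (n : ℤ) * (σ 3 n : ℤ) ≡ 3 * (σ 5 n : ℤ) [ZMOD 2 ^ 4 * 5]) ∧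
    (Nat.gcd n 30 = 1 →
      (σ 1 n : ℤ) + 10 * (3 * (n : ℤ) - 2) * (σ 7 n : ℤ)
        ≡ 11 * (σ 9 n : ℤ) [ZMOD 2 ^ 3 * 3 * 5]) := by
  have two_pow (h : n.Coprime 2) (k : ℕ) : n.Coprime (2 ^ k) := h.pow_right k
  have odd_coprime (h : ¬ 2 ∣ n) : n.Coprime 2 :=
    ((Nat.Prime.coprime_iff_not_dvd Nat.prime_two).2 h).symm
  have of_dvd {a b : ℕ} (h : Nat.gcd n b = 1) (hab : a ∣ b) : n.Coprime a :=
    Nat.Coprime.coprime_dvd_right hab h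
  refine ⟨fun h => ?_, fun h => ?_, fun h => ?_, ?_, fun h => ?_, fun h => ?_, fun h => ?_⟩
  · exact modEq_mul_of_coprime 8 3 (by norm_num)
      (sigma_congr_one_three (by decide +kernel) (by decide +kernel)
        (two_pow (of_dvd h (by norm_num)) 3))
      (sigma_congr_one_three (by decide +kernel) (by decide +kernel) (of_dvd h (by norm_num)))
  · exact sigma_congr_one_three_five (q := 16) (by decide +kernel) (by decide +kernel)
      (two_pow (odd_coprime h) 4)
  · exact modEq_mul_of_coprime (8 * 9) 7 (by norm_num)
      (modEq_mul_of_coprime 8 9 (by norm_num)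
        (sigma_congr_one_five_seven (by decide +kernel) (by decide +kernel)
          (two_pow (of_dvd h (by norm_num)) 3))
        (sigma_congr_one_five_seven (by decide +kernel) (by decide +kernel)
          ((of_dvd h (by norm_num) : n.Coprime 3).pow_right 2)))
      (sigma_congr_one_five_seven (by decide +kernel) (by decide +kernel)
        (of_dvd h (by norm_num)))
  · exact modEq_mul_of_coprime (32 * 3) 5 (by norm_num)
      (modEq_mul_of_coprime 32 3 (by norm_num) (sigma_congr_one_seven_nine_thirtytwo hn)
        (sigma_congr_one_seven_nine (by decide +kernel) (by decide +kernel)))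
      (sigma_congr_one_seven_nine (by decide +kernel) (by decide +kernel))
  · exact sigma_congr_five_one_seven_nine (q := 32) (by decide +kernel) (by decide +kernel)
      (two_pow (odd_coprime h) 5)
  · exact modEq_mul_of_coprime 16 5 (by norm_num)
      (sigma_congr_one_three_five (by decide +kernel) (by decide +kernel)
        (two_pow (of_dvd h (by norm_num)) 4))
      (sigma_congr_one_three_five (by decide +kernel) (by decide +kernel)
        (of_dvd h (by norm_num)))
  · exact modEq_mul_of_coprime (8 * 3) 5 (by norm_num)
      (modEq_mul_of_coprime 8 3 (by norm_num)
        (sigma_congr_one_seven_nine_of_coprime (by decide +kernel) (by decide +kernel)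
          (two_pow (of_dvd h (by norm_num)) 3))
        (sigma_congr_one_seven_nine_of_coprime (by decide +kernel) (by decide +kernel)
          (of_dvd h (by norm_num))))
      (sigma_congr_one_seven_nine_of_coprime (by decide +kernel) (by decide +kernel)
        (of_dvd h (by norm_num)))
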